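/- **Setting.** Let $G$ be a finite connected plane graph with nonnegative edge lengths and external face $f^\infty$. Let $P$ be a set of simple paths in $G$, each $p\in P$ with two distinct extremal vertices $x_p,y_p$ on $f^\infty$, such that every $p\in P$ is a shortest path of $G$, the intersection of any two paths of $P$ is a (possibly empty) path, and no two paths of $P$ cross each other in the embedding. Distinct paths have distinct terminal pairs $\{x_p,y_p\}$. Let $\gamma_p$ be the part of the boundary walk of $f^\infty$ that goes clockwise from $x_p$ to $y_p$ (if a vertex occurs several times on this walk, each terminal is given with a chosen occurrence). For all $p,q\in P$, either one of $\gamma_p,\gamma_q$ contains the other or they share no edge; and there is a root path $p_1\in P$ such that, with the terminals suitably ordered, $\gamma_p\subseteq\gamma_{p_1}$ for all $p\in P$. Write $p\preceq q$ if $\gamma_p\subseteq\gamma_q$; the genealogy tree of $P$ is the transitive reduction of $(P,\preceq)$. The set $P$ is assumed to be *binary*: every $p\in P$ has either no child or exactly two children in the genealogy tree, and in the latter case $p$ and its two children form a face, i.e. the boundary of some bounded face of $U=\bigcup_{p\in P}p$ is contained in the union of these three paths. For $p\in P$ let $\mathrm{Int}_p$ be the part of the plane graph bounded by $p$ and $\gamma_p$.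 For a bounded face $f$ of $U$, the *upper path* $q^f$ of $f$ is the minimum, with respect to $\preceq$, of the paths $p\in P$ with $f\subseteq \mathrm{Int}_p$, and the *lower boundary* of $f$ is $\partial f\setminus q^f$, the set of edges of $\partial f$ not in $q^f$; it is a path, and its two extremal edges are denoted by $e^f_r$ and $e^f_\ell$. Let $\mathcal L:P\to\{1,\dots,k\}$ be a path labeling; for an edge $e$ put $\mathcal L(e)=\{\mathcal L(p) : p\in P,\ e\in p\}$. A face $f$ is *solved* by $\mathcal L$ if $\mathcal L(e^f_r)\cap\mathcal L(e^f_\ell)=\emptyset$. **Theorem.** If every bounded face of $U$ is solved by $\mathcal L$, then $\mathcal L$ is a forest labeling: for every label $i\in\{1,\dots,k\}$ the graph $\bigcup_{p\in P,\ \mathcal L(p)=i}p$ is a forest. Equivalently, if for some label the union of the paths carrying it contains a cycle, then some bounded face of $U$ is not solved. -/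

import Mathlib

open scoped NNReal

namespace PlanePaths

/-- The orbit segment `a, f a, f² a, …` of a permutation `f`, stopped just before `b` is met:
`a` is included, `b` is not. -/
def orbitArc {α : Type*} (f : Equiv.Perm α) (a b : α) : Set α :=
  {d | ∃ n : ℕ, d = (f ^ n) a ∧ ∀ m ≤ n, (f ^ m) a ≠ b}

/-- The face permutation of a rotation system `rot` on a graph: run along the dart to its end,
turn back, and take the next dart there. -/
def facePerm {V : Type*} (G : SimpleGraph V) (rot : Equiv.Perm G.Dart) : Equiv.Perm G.Dart :=
  SimpleGraph.Dart.symm_involutive.toPerm.trans rot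

/-- A connected plane graph with nonnegative edge lengths, as a combinatorial map. `rot` lists the
darts leaving each vertex in clockwise order, so that the orbits of `facePerm` are the facial
walks, each with its face on the left. Planarity is Euler's formula. The external face is
the one to the left of the dart `outer`; its facial walk runs clockwise around the graph. -/
structure PlaneGraph (V : Type*) where
  graph : SimpleGraph V
  connected : graph.Connected
  rot : Equiv.Perm graph.Dart
  rot_sameCycle : ∀ d e : graph.Dart, rot.SameCycle d e ↔ d.fst = e.fst
  euler : Nat.card V + Nat.card (Quotient (Equiv.Perm.SameCycle.setoid (facePerm graph rot)))
    = Nat.card graph.edgeSet + 2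
  outer : graph.Dart
  length : Sym2 V → ℝ≥0

namespace PlaneGraph

variable {V : Type*} (G : PlaneGraph V)

/-- The face permutation of a plane graph. -/
def next : Equiv.Perm G.graph.Dart := facePerm G.graph G.rot

/-- `d` lies on the facial walk of the external face. -/
def IsOuter (d : G.graph.Dart) : Prop := G.next.SameCycle G.outer d

/-- Total length of a walk. -/
noncomputable def walkLength {u v : V} (w : G.graph.Walk u v) : ℝ≥0 :=
  (w.edges.map G.length).sum

/-- A dart stands for the part of a face just to its left. `Joined A K d d'` says that one can get
from `d` to `d'` without crossing an edge of `A`, moving along facial walks and across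
the edges outside `A`, where moreover a facial walk is blocked just before each dart of `K`. -/
def Joined (A : Set (Sym2 V)) (K : Set G.graph.Dart) : G.graph.Dart → G.graph.Dart → Prop :=
  Relation.EqvGen fun d d' => (d' = G.next d ∧ d' ∉ K) ∨ (d' = d.symm ∧ d.edge ∉ A)

/-- A simple path between two distinct vertices on the external face. As a vertex may occur more
than once on the external facial walk, an extremal vertex is given together with its place there:
`src` and `tgt` are the darts of that walk which leave the extremal vertices `x` and `y`
at the chosen places. (If the external face is bounded by a cycle, there is only one place.) -/
structure TerminalPath where
  src : G.graph.Dart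
  tgt : G.graph.Dart
  src_outer : G.IsOuter src
  tgt_outer : G.IsOuter tgt
  ne : src.fst ≠ tgt.fst
  walk : G.graph.Walk src.fst tgt.fst
  isPath : walk.IsPath

end PlaneGraph

namespace PlaneGraph.TerminalPath

variable {V : Type*} {G : PlaneGraph V}

/-- The edge set of a path. -/
def edges (p : G.TerminalPath) : Set (Sym2 V) := {e | e ∈ p.walk.edges}

/-- `γ_p`: the part of the external facial walk that goes clockwise from `x_p` to `y_p`. -/
def gamma (p : G.TerminalPath) : Set G.graph.Dart := orbitArc G.next p.src p.tgt

/-- `Int_p`: the side of `p` that contains `γ_p`. The path `p`, closed up by a curve through the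
external face from the place of `x_p` to the place of `y_p`, cuts the plane in two;
the side is given by the darts whose left-hand neighbourhood lies in it. -/
def inside (p : G.TerminalPath) : Set G.graph.Dart :=
  {d | ∃ c ∈ p.gamma, G.Joined p.edges {p.src, p.tgt} c d}

/-- Two paths are single-touch if their intersection is a (possibly empty) path. -/
def SingleTouch (p q : G.TerminalPath) : Prop :=
  p.walk.toSubgraph ⊓ q.walk.toSubgraph = ⊥ ∨
    ∃ (u v : V) (r : G.graph.Walk u v), r.IsPath ∧
      r.toSubgraph = p.walk.toSubgraph ⊓ q.walk.toSubgraph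

/-- At some interior vertex of `p`, with `s` the dart of `p` entering it and `t` the dart of `p`
leaving it, `q` has an edge strictly to the right of `p`: clockwise after `t`, before `s` reversed. -/
def HasEdgeRight (p q : G.TerminalPath) : Prop :=
  ∃ s t d : G.graph.Dart, [s, t] <:+: p.walk.darts ∧
    d ∈ orbitArc G.rot t s.symm ∧ d ≠ t ∧ d.edge ∈ q.edges

/-- The same as `HasEdgeRight`, on the left of `p`. -/
def HasEdgeLeft (p q : G.TerminalPath) : Prop :=
  ∃ s t d : G.graph.Dart, [s, t] <:+: p.walk.darts ∧
    d ∈ orbitArc G.rot s.symm t ∧ d ≠ s.symm ∧ d.edge ∈ q.edges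

/-- `q` crosses `p`: it leaves `p` on both sides. (Used for single-touch paths only: they
have at most one common subpath, and `q` comes to it from one side and goes off to the other.) -/
def Crosses (q p : G.TerminalPath) : Prop := HasEdgeRight p q ∧ HasEdgeLeft p q

end PlaneGraph.TerminalPath

section Family

variable {V : Type*} {G : PlaneGraph V} {ι : Type*} (P : ι → G.TerminalPath)

/-- A set of non-crossing shortest paths with ends on the external face, with the usual
normalizations: terminal pairs are distinct and well-formed, and the terminals of each path are
ordered with respect to a root path: no terminal lies strictly inside the part of the
external walk from `y` to `x` of the root, and no `γ` uses that part. -/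
structure IsNCS (root : ι) : Prop where
  shortest : ∀ i, ∀ w : G.graph.Walk (P i).src.fst (P i).tgt.fst,
    G.walkLength (P i).walk ≤ G.walkLength w
  singleTouch : ∀ i j, i ≠ j → (P i).SingleTouch (P j)
  nonCrossing : ∀ i j, i ≠ j → ¬ (P i).Crosses (P j)
  distinct : ∀ i j, i ≠ j →
    s((P i).src.fst, (P i).tgt.fst) ≠ s((P j).src.fst, (P j).tgt.fst)
  wellFormed : ∀ i j, (P i).gamma ⊆ (P j).gamma ∨ (P j).gamma ⊆ (P i).gamma ∨
    Disjoint (P i).gamma (P j).gamma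
  root_max : ∀ i, (P i).gamma ⊆ (P root).gamma

/-- `c` is a child of `p` in the genealogy tree, the transitive reduction of the order
`p ≼ q ↔ γ_p ⊆ γ_q`. -/
def IsChild (c p : ι) : Prop :=
  (P c).gamma ⊂ (P p).gamma ∧ ¬ ∃ r, (P c).gamma ⊂ (P r).gamma ∧ (P r).gamma ⊂ (P p).gamma

/-- The edge set of the union `U` of all paths. -/
def unionEdges : Set (Sym2 V) := ⋃ i, (P i).edges

/-- A face of `U`, as the set of darts of `G` whose left-hand neighbourhood lies in it. -/
def IsFace (f : Set G.graph.Dart) : Prop :=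
  ∃ d, f = {d' | G.Joined (unionEdges P) ∅ d d'}

/-- The edges of `U` on the boundary of `f`. -/
def boundary (f : Set G.graph.Dart) : Set (Sym2 V) :=
  {e | e ∈ unionEdges P ∧ ∃ d ∈ f, d.edge = e}

/-- A binary set of non-crossing shortest paths: each path has no child or exactly two, and in the
latter case it forms a bounded face of `U` together with its two children. -/
structure IsBinaryNCS (root : ι) : Prop extends IsNCS P root where
  binary : ∀ p, (∀ c, ¬ IsChild P c p) ∨
    ∃ c₁ c₂, c₁ ≠ c₂ ∧ (∀ c, IsChild P c p ↔ c = c₁ ∨ c = c₂) ∧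
      ∃ f, IsFace P f ∧ G.outer ∉ f ∧
        boundary P f ⊆ (P p).edges ∪ (P c₁).edges ∪ (P c₂).edges

/-- `q` is the upper path of `f`: the minimum among the paths `p` with `f` inside `Int_p`. -/
def IsUpperPath (q : ι) (f : Set G.graph.Dart) : Prop :=
  f ⊆ (P q).inside ∧ ∀ r, f ⊆ (P r).inside → (P q).gamma ⊆ (P r).gamma

/-- The lower boundary of a face `f` with upper path `q`. -/
def lowerBoundary (q : ι) (f : Set G.graph.Dart) : Set (Sym2 V) := boundary P f \ (P q).edges

/-- `v` is an end of the path with edge set `B`, and `e` is the extremal edge there. -/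
def IsExtremal (B : Set (Sym2 V)) (v : V) (e : Sym2 V) : Prop :=
  e ∈ B ∧ v ∈ e ∧ ∀ e' ∈ B, v ∈ e' → e' = e

variable {k : ℕ} (L : ι → Fin k)

/-- The labels carried by an edge. -/
def edgeLabels (e : Sym2 V) : Set (Fin k) := {c | ∃ i, e ∈ (P i).edges ∧ L i = c}

/-- `f` is solved by `L`: the extremal edges at the two ends of its lower boundary carry disjoint
sets of labels. -/
def IsSolved (f : Set G.graph.Dart) : Prop :=
  ∀ q, IsUpperPath P q f → ∀ v v' e e', v ≠ v' →
    IsExtremal (lowerBoundary P q f) v e → IsExtremal (lowerBoundary P q f) v' e' →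
      Disjoint (edgeLabels P L e) (edgeLabels P L e')

/-- `L` is a forest labeling: the union of the paths of each label is a forest. -/
def IsForestLabeling : Prop :=
  ∀ c, (⨆ i ∈ {i | L i = c}, (P i).walk.toSubgraph).coe.IsAcyclic

end Family

end PlanePaths

/-! Fix a label and let A be the set of edges of its paths. A cycle of edges in A would separate the
plane, so it suffices that every face can be joined to the external face without crossing A.

This connectivity is proved by induction on γ_p for darts in `Int_p`. Let f be a bounded face of U
with upper path p. Its lower boundary is not empty, since otherwise the boundary of f would lie on a
simple path, which does not separate the plane. By minimality of p, it lies on children of p, of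
which there are at most two, and crossing any of its edges leads into `Int_c` for a child c. As the
children touch in a single subpath, the lower boundary has two ends; since f is solved, one of the
two extremal edges avoids the label. Crossing that edge, the induction continues from c
(`IsBinaryNCS.joined_outer`).

Topology is replaced by homology modulo 2: by Euler's formula, every cycle is the boundary of a set
of faces (`exists_faceSum_eq`). This gives the two sides of a path closed up through the external
face (`exists_side`) and the separation by a cycle (`coe_isAcyclic_of_joined`). Relative positions
of paths are read off the external walk (`mem_inside_iff_gamma_subset`): by single touch, from an
edge of p off q one can follow p to a terminal without meeting q. -/

namespace PlanePaths

/-! ### Edge chains modulo 2 -/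

section Chains

variable {V : Type*} {G : SimpleGraph V}

theorem finite_dart [Finite V] : Finite G.Dart :=
  Finite.of_injective _ (SimpleGraph.Dart.toProd_injective (G := G))

theorem count_edges_eq_ite [DecidableEq V] {u u' : V} {w : G.Walk u u'} (hw : w.IsTrail) (e : Sym2 V) :
    (w.edges.count e : ZMod 2) = if e ∈ w.edges then 1 else 0 := by
  split_ifs with h
  · simp [List.count_eq_one_of_mem hw.edges_nodup h]
  · simp [List.count_eq_zero_of_not_mem h]

variable [Fintype G.Dart] [DecidableEq V]

/-- An edge has exactly one dart leaving each of its ends. -/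
theorem sum_dart_edge_eq (d₀ : G.Dart) (v : V) :
    (∑ d : G.Dart with d.fst = v, if d.edge = d₀.edge then (1 : ZMod 2) else 0)
      = (if d₀.fst = v then 1 else 0) + (if d₀.snd = v then 1 else 0) := by
  classical
  have h : ∀ d : G.Dart, (if d.fst = v then if d.edge = d₀.edge then (1 : ZMod 2) else 0 else 0)
      = (if d = d₀ then if d₀.fst = v then 1 else 0 else 0)
        + (if d = d₀.symm then if d₀.snd = v then 1 else 0 else 0) := by
    intro d
    by_cases h₁ : d = d₀
    · subst h₁
      simp [(SimpleGraph.Dart.symm_ne d).symm]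
    · by_cases h₂ : d = d₀.symm
      · subst h₂
        simp [SimpleGraph.Dart.symm_ne d₀]
      · have h₃ : d.edge ≠ d₀.edge := fun h => by
          rcases (SimpleGraph.dart_edge_eq_iff _ _).1 h with h | h <;> contradiction
        simp [h₁, h₂, h₃]
  rw [Finset.sum_filter, Finset.sum_congr rfl fun d _ => h d, Finset.sum_add_distrib]
  simp

/-- The edge chain of a walk modulo 2 has the two ends of the walk as boundary. -/
theorem sum_dart_count_edges {u u' : V} (w : G.Walk u u') (v : V) :
    (∑ d : G.Dart with d.fst = v, (w.edges.count d.edge : ZMod 2))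
      = (if u = v then 1 else 0) + (if u' = v then 1 else 0) := by
  induction w with
  | nil =>
    simp only [SimpleGraph.Walk.edges_nil, List.count_nil, Nat.cast_zero, Finset.sum_const_zero]
    exact (CharTwo.add_self_eq_zero _).symm
  | @cons a b c h p ih =>
    have h₁ := sum_dart_edge_eq (G := G) ⟨(a, b), h⟩ v
    simp only [SimpleGraph.Walk.edges_cons, List.count_cons, Nat.cast_add, Finset.sum_add_distrib,
      ih]
    have h₂ : ∀ d : G.Dart, (((if (s(a, b) == d.edge) = true then 1 else 0 : ℕ)) : ZMod 2)
        = if d.edge = (⟨(a, b), h⟩ : G.Dart).edge then 1 else 0 := by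
      intro d
      have : (⟨(a, b), h⟩ : G.Dart).edge = s(a, b) := rfl
      rw [this]
      by_cases h₃ : d.edge = s(a, b)
      · simp [h₃]
      · simp [h₃, Ne.symm h₃]
    rw [Finset.sum_congr rfl fun d _ => h₂ d, h₁]
    have h₄ := CharTwo.add_self_eq_zero (if b = v then (1 : ZMod 2) else 0)
    linear_combination h₄

/-- The boundary map on edge chains modulo 2. -/
def vertexSum : (G.edgeSet → ZMod 2) →ₗ[ZMod 2] (V → ZMod 2) where
  toFun c v := ∑ d : G.Dart with d.fst = v, c ⟨d.edge, d.edge_mem⟩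
  map_add' c c' := by
    funext v
    simp [Finset.sum_add_distrib]
  map_smul' r c := by
    funext v
    simp [Finset.mul_sum]

end Chains

/-! ### The dual graph, face chains and exactness from Euler's formula -/

namespace PlaneGraph

variable {V : Type*} (G : PlaneGraph V)

theorem rot_eq (d : G.graph.Dart) : G.rot d = G.next d.symm := by
  change G.rot d = G.rot d.symm.symm
  rw [SimpleGraph.Dart.symm_symm]

theorem fst_rot (d : G.graph.Dart) : (G.rot d).fst = d.fst :=
  ((G.rot_sameCycle d (G.rot d)).1 ⟨1, by simp⟩).symm

theorem fst_next_symm (d : G.graph.Dart) : (G.next d.symm).fst = d.fst := by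
  rw [← rot_eq, fst_rot]

/-- Summing over the darts at a vertex is invariant under rotation. -/
theorem sum_rot [Fintype G.graph.Dart] [DecidableEq V] (f : G.graph.Dart → ZMod 2) (v : V) :
    (∑ d : G.graph.Dart with d.fst = v, f (G.rot d)) = ∑ d : G.graph.Dart with d.fst = v, f d := by
  refine Finset.sum_equiv G.rot (fun d => ?_) fun d _ => rfl
  simp [fst_rot]

/-- A property of darts that is invariant under rotation holds at all darts of a vertex or none. -/
theorem rot_invariant {X : Type*} [Finite V] {g : G.graph.Dart → X} {v : V}
    (h : ∀ d, d.fst = v → g (G.rot d) = g d) {d d' : G.graph.Dart} (hd : d.fst = v)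
    (hd' : d'.fst = v) : g d = g d' := by
  have : Finite G.graph.Dart := finite_dart
  obtain ⟨n, hn⟩ := ((G.rot_sameCycle d d').2 (hd.trans hd'.symm)).exists_nat_pow_eq
  have key : ∀ n : ℕ, ((G.rot ^ n) d).fst = v ∧ g ((G.rot ^ n) d) = g d := by
    intro n
    induction n with
    | zero => exact ⟨hd, rfl⟩
    | succ n ih =>
      rw [pow_succ', Equiv.Perm.mul_apply]
      exact ⟨(G.fst_rot _).trans ih.1, (h _ ih.1).trans ih.2⟩
  rw [← hn, (key n).2]

/-- The dual graph of a connected map is connected. -/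
theorem eq_of_invariant {X : Type*} [Finite V] {g : G.graph.Dart → X}
    (hn : ∀ d, g (G.next d) = g d) (hs : ∀ d : G.graph.Dart, g d.symm = g d)
    (d d' : G.graph.Dart) : g d = g d' := by
  have hr : ∀ d, g (G.rot d) = g d := fun d => by rw [rot_eq, hn, hs]
  have key : ∀ (u v : V) (_ : G.graph.Walk u v) (a b : G.graph.Dart), a.fst = u → b.fst = v →
      g a = g b := by
    intro u v w
    induction w with
    | nil => exact fun a b ha hb => G.rot_invariant (fun d _ => hr d) ha hb
    | @cons x y z h p ih =>
      intro a b ha hb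
      rw [G.rot_invariant (fun d _ => hr d) ha (d' := ⟨(x, y), h⟩) rfl, ← hs]
      exact ih _ b rfl hb
  exact key d.fst d'.fst (G.connected.preconnected _ _).some d d' rfl rfl

/-- The faces of a plane graph. -/
def Face : Type _ := Quotient (Equiv.Perm.SameCycle.setoid G.next)

/-- The face to the left of a dart. -/
def face (d : G.graph.Dart) : G.Face := Quotient.mk _ d

theorem face_next (d : G.graph.Dart) : G.face (G.next d) = G.face d :=
  Quotient.sound (s := Equiv.Perm.SameCycle.setoid G.next) ⟨-1, by simp⟩

/-- A dart of an edge. -/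
noncomputable def edgeDart (e : G.graph.edgeSet) : G.graph.Dart :=
  Classical.choose (show ∃ d : G.graph.Dart, d.edge = e by
    obtain ⟨⟨a, b⟩, h⟩ := e
    exact ⟨⟨(a, b), h⟩, rfl⟩)

theorem edge_edgeDart (e : G.graph.edgeSet) : (G.edgeDart e).edge = e :=
  Classical.choose_spec (show ∃ d : G.graph.Dart, d.edge = e by
    obtain ⟨⟨a, b⟩, h⟩ := e
    exact ⟨⟨(a, b), h⟩, rfl⟩)

/-- The boundary map on face chains modulo 2. -/
noncomputable def faceSum : (G.Face → ZMod 2) →ₗ[ZMod 2] (G.graph.edgeSet → ZMod 2) where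
  toFun y e := y (G.face (G.edgeDart e)) + y (G.face (G.edgeDart e).symm)
  map_add' y y' := by
    funext e
    simp only [Pi.add_apply]
    ring
  map_smul' r y := by
    funext e
    simp [mul_add]

theorem faceSum_apply (y : G.Face → ZMod 2) (d : G.graph.Dart) :
    G.faceSum y ⟨d.edge, d.edge_mem⟩ = y (G.face d) + y (G.face d.symm) := by
  change y (G.face (G.edgeDart _)) + y (G.face (G.edgeDart _).symm) = _
  rcases (SimpleGraph.dart_edge_eq_iff _ _).1 (G.edge_edgeDart ⟨d.edge, d.edge_mem⟩) with h | h
  · rw [h]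
  · rw [h, SimpleGraph.Dart.symm_symm, add_comm]

/-- A face chain in the kernel has equal values on the two sides of each edge, so it is constant
because the dual graph is connected. -/
theorem finrank_ker_faceSum_le [Finite V] : Module.finrank (ZMod 2) G.faceSum.ker ≤ 1 := by
  refine finrank_le_one (⟨fun _ => 1, ?_⟩ : G.faceSum.ker) fun ⟨y, hy⟩ => ?_
  · rw [LinearMap.mem_ker]
    funext e
    exact CharTwo.add_self_eq_zero (1 : ZMod 2)
  · refine ⟨y (G.face G.outer), Subtype.ext ?_⟩
    funext q
    induction q using Quotient.inductionOn with
    | _ d =>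
    have h := G.eq_of_invariant (g := fun d => y (G.face d)) (fun d => by rw [face_next])
      (fun d => ?_) G.outer d
    · exact (mul_one _).trans h
    · have := congrFun (LinearMap.mem_ker.1 hy) ⟨d.edge, d.edge_mem⟩
      rw [faceSum_apply] at this
      exact (CharTwo.add_eq_zero.1 this).symm

section Exact

variable [Fintype G.graph.Dart] [DecidableEq V]

/-- The face of `d.symm` is the face of `rot d`, so around a vertex every corner is counted twice.
-/
theorem vertexSum_faceSum (y : G.Face → ZMod 2) : vertexSum (G.faceSum y) = 0 := by
  funext v
  change (∑ d : G.graph.Dart with d.fst = v, G.faceSum y ⟨d.edge, d.edge_mem⟩) = 0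
  have h : ∀ d : G.graph.Dart, G.faceSum y ⟨d.edge, d.edge_mem⟩
      = y (G.face d) + y (G.face (G.rot d)) := fun d => by
    rw [faceSum_apply, rot_eq, face_next]
  rw [Finset.sum_congr rfl fun d _ => h d, Finset.sum_add_distrib,
    G.sum_rot (fun d => y (G.face d))]
  exact CharTwo.add_self_eq_zero _

theorem single_add_single_mem_range (u v : V) :
    (Pi.single u 1 + Pi.single v 1 : V → ZMod 2) ∈ (vertexSum (G := G.graph)).range := by
  obtain ⟨w⟩ := G.connected.preconnected u v
  refine ⟨fun e => (w.edges.count (e : Sym2 V) : ZMod 2), ?_⟩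
  funext x
  refine (sum_dart_count_edges w x).trans ?_
  simp [Pi.single_apply, eq_comm]

/-- By connectedness any two vertices bound a walk, so the range together with one basis vector
spans everything. -/
theorem card_le_finrank_range_vertexSum [Fintype V] :
    Fintype.card V ≤ Module.finrank (ZMod 2) (vertexSum (G := G.graph)).range + 1 := by
  set R := (vertexSum (G := G.graph)).range
  have htop : R ⊔ Submodule.span (ZMod 2) {Pi.single G.outer.fst 1} = ⊤ := by
    rw [eq_top_iff]
    intro f _
    rw [pi_eq_sum_univ' f]
    refine Submodule.sum_mem _ fun v _ => Submodule.smul_mem _ _ ?_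
    have h₁ := Submodule.mem_sup_left (T := Submodule.span (ZMod 2) {Pi.single G.outer.fst 1})
      (G.single_add_single_mem_range v G.outer.fst)
    have h₂ := Submodule.mem_sup_right (S := R)
      (Submodule.mem_span_singleton_self (Pi.single G.outer.fst (1 : ZMod 2) : V → ZMod 2))
    have h₃ := Submodule.sub_mem _ h₁ h₂
    rw [add_sub_cancel_right] at h₃
    convert h₃ using 1
  have h₁ := Submodule.finrank_add_le_finrank_add_finrank R
    (Submodule.span (ZMod 2) {Pi.single G.outer.fst (1 : ZMod 2)})
  rw [htop, finrank_top, Module.finrank_fintype_fun_eq_card] at h₁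
  have h₂ := finrank_span_singleton (K := ZMod 2)
    (v := (Pi.single G.outer.fst (1 : ZMod 2) : V → ZMod 2)) (by simp)
  omega

/-- In a plane graph, every cycle modulo 2 is the boundary of a set of faces. -/
theorem exists_faceSum_eq [Finite V] {c : G.graph.edgeSet → ZMod 2} (hc : vertexSum c = 0) :
    ∃ y, G.faceSum y = c := by
  have := Fintype.ofFinite V
  have : Finite G.Face := Quotient.finite _
  have := Fintype.ofFinite G.Face
  have := Fintype.ofFinite G.graph.edgeSet
  have hle : G.faceSum.range ≤ (vertexSum (G := G.graph)).ker := by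
    rintro _ ⟨y, rfl⟩
    exact G.vertexSum_faceSum y
  have h₁ := G.card_le_finrank_range_vertexSum
  have h₂ := G.finrank_ker_faceSum_le
  have h₃ := LinearMap.finrank_range_add_finrank_ker G.faceSum
  have h₄ := LinearMap.finrank_range_add_finrank_ker (vertexSum (G := G.graph))
  rw [Module.finrank_fintype_fun_eq_card] at h₃ h₄
  have h₅ : Fintype.card V + Fintype.card G.Face = Fintype.card G.graph.edgeSet + 2 := by
    have h := G.euler
    rw [Nat.card_eq_fintype_card, Nat.card_eq_fintype_card (α := G.graph.edgeSet)] at h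
    rw [← h, ← Nat.card_eq_fintype_card (α := G.Face)]
    rfl
  -- With F faces, the range has dimension at least F - 1, while the kernel of `vertexSum` has
  -- dimension at most E - V + 1, which is F - 1 by Euler's formula.
  have h₆ : G.faceSum.range = (vertexSum (G := G.graph)).ker :=
    Submodule.eq_of_le_of_finrank_le hle (by omega)
  have h₇ : c ∈ G.faceSum.range := h₆ ▸ LinearMap.mem_ker.2 hc
  exact h₇

end Exact

/-- A symmetric function on the darts which sums to zero at every vertex comes from a
two-colouring of the faces. -/
theorem exists_face_coloring [Finite V] [Fintype G.graph.Dart] [DecidableEq V]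
    (c : G.graph.Dart → ZMod 2) (hc : ∀ d : G.graph.Dart, c d.symm = c d)
    (hv : ∀ v, (∑ d : G.graph.Dart with d.fst = v, c d) = 0) :
    ∃ x : G.graph.Dart → ZMod 2, (∀ d, x (G.next d) = x d) ∧ ∀ d, x d + x d.symm = c d := by
  have hce : ∀ d : G.graph.Dart, c (G.edgeDart ⟨d.edge, d.edge_mem⟩) = c d := fun d => by
    rcases (SimpleGraph.dart_edge_eq_iff _ _).1 (G.edge_edgeDart ⟨d.edge, d.edge_mem⟩) with h | h
    · rw [h]
    · rw [h, hc]
  obtain ⟨y, hy⟩ := G.exists_faceSum_eq (c := fun e => c (G.edgeDart e)) (by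
    funext v
    refine Eq.trans ?_ (hv v)
    exact Finset.sum_congr rfl fun d _ => hce d)
  refine ⟨fun d => y (G.face d), fun d => congrArg y (G.face_next d), fun d => ?_⟩
  have := congrFun hy ⟨d.edge, d.edge_mem⟩
  rw [faceSum_apply] at this
  rw [this, hce]

end PlaneGraph

/-! ### Arcs of a cycle of a permutation -/

section OrbitArc

variable {α : Type*} {f : Equiv.Perm α} {a b d : α}

theorem left_mem_orbitArc (hab : a ≠ b) : a ∈ orbitArc f a b :=
  ⟨0, by simp, fun m hm => by simpa [Nat.le_zero.1 hm] using hab⟩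

theorem right_notMem_orbitArc : b ∉ orbitArc f a b :=
  fun ⟨n, hn, h⟩ => h n le_rfl hn.symm

theorem apply_mem_orbitArc (hd : d ∈ orbitArc f a b) (hb : f d ≠ b) : f d ∈ orbitArc f a b := by
  obtain ⟨n, rfl, h⟩ := hd
  refine ⟨n + 1, by rw [pow_succ', Equiv.Perm.mul_apply], fun m hm => ?_⟩
  rcases Nat.le_succ_iff.1 hm with hm | rfl
  · exact h m hm
  · rwa [Nat.succ_eq_add_one, pow_succ', Equiv.Perm.mul_apply]

theorem mem_orbitArc_of_apply_mem (hd : f d ∈ orbitArc f a b) (ha : f d ≠ a) :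
    d ∈ orbitArc f a b := by
  obtain ⟨n, hn, h⟩ := hd
  cases n with
  | zero => exact absurd (by simpa using hn) ha
  | succ n =>
    rw [pow_succ', Equiv.Perm.mul_apply] at hn
    exact ⟨n, f.injective hn, fun m hm => h m (hm.trans n.le_succ)⟩

theorem apply_mem_orbitArc_iff (ha : f d ≠ a) (hb : f d ≠ b) :
    f d ∈ orbitArc f a b ↔ d ∈ orbitArc f a b :=
  ⟨fun h => mem_orbitArc_of_apply_mem h ha, fun h => apply_mem_orbitArc h hb⟩

variable [Finite α]

theorem mem_orbitArc_of_apply_eq_right (hab : a ≠ b) (h : f.SameCycle a b) (hd : f d = b) :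
    d ∈ orbitArc f a b := by
  classical
  have hex := h.exists_nat_pow_eq
  obtain ⟨n, hn⟩ : ∃ n, Nat.find hex = n + 1 := Nat.exists_eq_succ_of_ne_zero fun h0 =>
    hab (by simpa [h0] using Nat.find_spec hex)
  refine ⟨n, f.injective ?_, fun m hm => Nat.find_min hex (by omega)⟩
  rw [hd, ← Equiv.Perm.mul_apply, ← pow_succ', ← hn, Nat.find_spec hex]

theorem notMem_orbitArc_of_apply_eq_left (h : f.SameCycle a b) (hd : f d = a) :
    d ∉ orbitArc f a b := by
  rintro ⟨n, rfl, hn⟩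
  rw [← Equiv.Perm.mul_apply, ← pow_succ'] at hd
  obtain ⟨m, hm⟩ := h.exists_nat_pow_eq
  -- The orbit of `a` closes up after `n + 1` steps, so `b` would already occur among the first `n`
  -- iterates, which the arc excludes.
  refine hn (m % (n + 1)) (Nat.lt_succ_iff.1 (Nat.mod_lt _ n.succ_pos)) ?_
  rw [← hm]
  conv_rhs => rw [← Nat.mod_add_div m (n + 1), pow_add, pow_mul, Equiv.Perm.mul_apply]
  rw [((f ^ (n + 1)).pow_apply_eq_self_of_apply_eq_self hd _)]

end OrbitArc

/-! ### The two sides of a path closed up through the external face -/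

namespace PlaneGraph

variable {V : Type*} {G : PlaneGraph V}

namespace Joined

variable {A : Set (Sym2 V)} {K : Set G.graph.Dart} {d d' d'' : G.graph.Dart}

theorem refl (d : G.graph.Dart) : G.Joined A K d d := Relation.EqvGen.refl d

theorem symm (h : G.Joined A K d d') : G.Joined A K d' d := Relation.EqvGen.symm _ _ h

theorem trans (h : G.Joined A K d d') (h' : G.Joined A K d' d'') : G.Joined A K d d'' :=
  Relation.EqvGen.trans _ _ _ h h'

theorem next (h : G.next d ∉ K) : G.Joined A K d (G.next d) :=
  Relation.EqvGen.rel _ _ (Or.inl ⟨rfl, h⟩)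

theorem cross (h : d.edge ∉ A) : G.Joined A K d d.symm :=
  Relation.EqvGen.rel _ _ (Or.inr ⟨rfl, h⟩)

/-- All invariants of faces and sides are propagated this way: an equivalence is checked on the two
elementary moves only. -/
theorem rel_of_equivalence {r : G.graph.Dart → G.graph.Dart → Prop} (hr : Equivalence r)
    (hn : ∀ d, G.next d ∉ K → r d (G.next d)) (hs : ∀ d : G.graph.Dart, d.edge ∉ A → r d d.symm)
    (h : G.Joined A K d d') : r d d' := by
  induction h with
  | rel x y h =>
    rcases h with ⟨rfl, h⟩ | ⟨rfl, h⟩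
    · exact hn x h
    · exact hs x h
  | refl x => exact hr.refl x
  | symm x y _ ih => exact hr.symm ih
  | trans x y z _ _ ih ih' => exact hr.trans ih ih'

theorem mono {B : Set (Sym2 V)} (hAB : B ⊆ A) (h : G.Joined A K d d') : G.Joined B K d d' :=
  rel_of_equivalence (r := G.Joined B K) ⟨refl, symm, trans⟩ (fun _ h => next h)
    (fun _ h => cross fun h' => h (hAB h')) h

theorem mem_iff {X : Set G.graph.Dart} (hn : ∀ d, G.next d ∉ K → (G.next d ∈ X ↔ d ∈ X))
    (hs : ∀ d : G.graph.Dart, d.edge ∉ A → (d.symm ∈ X ↔ d ∈ X)) (h : G.Joined A K d d') :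
    d ∈ X ↔ d' ∈ X :=
  rel_of_equivalence (r := fun d d' => d ∈ X ↔ d' ∈ X) ⟨fun _ => Iff.rfl, Iff.symm, Iff.trans⟩
    (fun d h => (hn d h).symm) (fun d h => (hs d h).symm) h

end Joined

theorem isOuter_next_iff {d : G.graph.Dart} : G.IsOuter (G.next d) ↔ G.IsOuter d :=
  Equiv.Perm.sameCycle_apply_right

theorem joined_outer_of_isOuter [Finite V] {A : Set (Sym2 V)} {d : G.graph.Dart}
    (h : G.IsOuter d) : G.Joined A ∅ G.outer d := by
  have : Finite G.graph.Dart := finite_dart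
  obtain ⟨n, rfl⟩ := Equiv.Perm.SameCycle.exists_nat_pow_eq h
  clear h
  induction n with
  | zero => exact Joined.refl _
  | succ n ih =>
    rw [pow_succ', Equiv.Perm.mul_apply]
    exact ih.trans (Joined.next (Set.notMem_empty _))

/-- A union of faces whose boundary lies on a simple path is trivial. -/
theorem symm_mem_iff_of_isPath [Finite V] {X : Set G.graph.Dart}
    (hn : ∀ d, G.next d ∈ X ↔ d ∈ X) {u v : V} {w : G.graph.Walk u v} (hw : w.IsPath)
    (hs : ∀ d : G.graph.Dart, d.edge ∉ w.edges → (d.symm ∈ X ↔ d ∈ X)) (d : G.graph.Dart) :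
    d.symm ∈ X ↔ d ∈ X := by
  classical
  have : Finite G.graph.Dart := finite_dart
  have := Fintype.ofFinite G.graph.Dart
  induction w with
  | nil => exact hs d (by simp)
  | @cons a b c h p ih =>
    rw [SimpleGraph.Walk.cons_isPath_iff] at hw
    refine ih hw.1 fun d hd => ?_
    by_cases hde : d.edge = s(a, b)
    · set d₀ : G.graph.Dart := ⟨(a, b), h⟩
      have hrest : ∀ d : G.graph.Dart, d.fst = a → d ≠ d₀ → (d.symm ∈ X ↔ d ∈ X) := by
        intro d hda hd₀
        refine hs d ?_
        rw [SimpleGraph.Walk.edges_cons, List.mem_cons, not_or]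
        refine ⟨fun he => ?_, fun he => hw.2 (p.mem_support_of_mem_edges he (hda ▸ by
          simp [SimpleGraph.Dart.edge]))⟩
        rcases (SimpleGraph.dart_edge_eq_iff d d₀).1 he with h₁ | h₁
        · exact hd₀ h₁
        · rw [h₁] at hda
          exact h.ne hda.symm
      -- The boundary of a union of faces has even degree at every vertex, and `d₀` is the only dart
      -- at the start `a` of the path whose edge could belong to it. So edges are peeled off from
      -- the start.
      have h₀ : d₀.symm ∈ X ↔ d₀ ∈ X := by
        let χ : G.graph.Dart → ZMod 2 := fun d => if d ∈ X then 1 else 0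
        have hsum : (∑ d : G.graph.Dart with d.fst = a, (χ d + χ d.symm)) = 0 := by
          have : ∀ d : G.graph.Dart, χ d.symm = χ (G.rot d) := fun d => by
            simp only [χ, rot_eq, hn]
          simp only [this, Finset.sum_add_distrib, G.sum_rot χ]
          exact CharTwo.add_self_eq_zero _
        rw [Finset.sum_eq_single_of_mem d₀ (by simp [d₀]) fun d hd hne => by
          have := hrest d (by simpa using hd) hne
          simp only [χ, this]
          exact CharTwo.add_self_eq_zero _] at hsum
        have h₁ := CharTwo.add_eq_zero.1 hsum
        by_cases h₂ : d₀ ∈ X <;> by_cases h₃ : d₀.symm ∈ X <;> simp_all [χ]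
      rcases (SimpleGraph.dart_edge_eq_iff d d₀).1 hde with rfl | rfl
      · exact h₀
      · rw [SimpleGraph.Dart.symm_symm]
        exact h₀.symm
    · exact hs d (by simp [hde, hd])

/-- A nonempty union of faces whose boundary lies on a simple path contains everything. -/
theorem mem_of_boundary_isPath [Finite V] {X : Set G.graph.Dart}
    (hn : ∀ d, G.next d ∈ X ↔ d ∈ X) {u v : V} {w : G.graph.Walk u v} (hw : w.IsPath)
    (hs : ∀ d : G.graph.Dart, d.edge ∉ w.edges → (d.symm ∈ X ↔ d ∈ X)) {d d' : G.graph.Dart}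
    (hd : d ∈ X) : d' ∈ X :=
  (G.eq_of_invariant (g := fun d => d ∈ X) (fun d => propext (hn d))
    (fun d => propext (symm_mem_iff_of_isPath hn hw hs d)) d d').mp hd

namespace TerminalPath

variable (p : G.TerminalPath)

theorem src_ne_tgt : p.src ≠ p.tgt := fun h => p.ne (congrArg (fun d => d.fst) h)

theorem sameCycle : G.next.SameCycle p.src p.tgt :=
  p.src_outer.symm.trans p.tgt_outer

theorem src_mem_gamma : p.src ∈ p.gamma := left_mem_orbitArc p.src_ne_tgt

theorem tgt_notMem_gamma : p.tgt ∉ p.gamma := right_notMem_orbitArc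

section

variable {p} {d : G.graph.Dart}

theorem next_mem_gamma_iff (ha : G.next d ≠ p.src) (hb : G.next d ≠ p.tgt) :
    G.next d ∈ p.gamma ↔ d ∈ p.gamma := apply_mem_orbitArc_iff ha hb

theorem mem_gamma_of_next_eq_tgt [Finite V] (h : G.next d = p.tgt) : d ∈ p.gamma :=
  have : Finite G.graph.Dart := finite_dart
  mem_orbitArc_of_apply_eq_right p.src_ne_tgt p.sameCycle h

theorem notMem_gamma_of_next_eq_src [Finite V] (h : G.next d = p.src) : d ∉ p.gamma :=
  have : Finite G.graph.Dart := finite_dart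
  notMem_orbitArc_of_apply_eq_left p.sameCycle h

end

/-- A simple path, closed up through the external face, separates the plane. -/
theorem exists_side [Finite V] : ∃ X : Set G.graph.Dart,
    (∀ d, G.next d ∉ ({p.src, p.tgt} : Set G.graph.Dart) → (G.next d ∈ X ↔ d ∈ X)) ∧
    (∀ d : G.graph.Dart, d.edge ∉ p.edges → (d.symm ∈ X ↔ d ∈ X)) ∧
    (∀ d : G.graph.Dart, d.edge ∈ p.edges → (d.symm ∈ X ↔ d ∉ X)) ∧
    ∀ d, G.IsOuter d → (d ∈ X ↔ d ∈ p.gamma) := by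
  classical
  have : Finite G.graph.Dart := finite_dart
  have := Fintype.ofFinite G.graph.Dart
  -- The indicator of γ has the right values on the external walk, but jumps at `src` and `tgt`. A
  -- face colouring `x` is sought that corrects it so that the sum changes exactly across the path.
  let s₀ : G.graph.Dart → ZMod 2 := fun d => if d ∈ p.gamma then 1 else 0
  let e : G.graph.Dart → ZMod 2 := fun d => if d.edge ∈ p.edges then 1 else 0
  have hs₀ : ∀ d, s₀ (G.next d) = s₀ d + (if G.next d = p.src then 1 else 0)
      + (if G.next d = p.tgt then 1 else 0) := by
    intro d
    by_cases h₁ : G.next d = p.src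
    · simp [s₀, h₁, p.src_mem_gamma, notMem_gamma_of_next_eq_src h₁, p.src_ne_tgt]
    · by_cases h₂ : G.next d = p.tgt
      · simp [s₀, h₂, p.tgt_notMem_gamma, mem_gamma_of_next_eq_tgt h₂, p.src_ne_tgt.symm]
        rfl
      · simp [s₀, h₁, h₂, next_mem_gamma_iff h₁ h₂]
  -- The prescribed chain is a cycle: the two ends of the path cancel the two jumps of `s₀`.
  obtain ⟨x, hx, hxe⟩ := G.exists_face_coloring (fun d => e d + s₀ d + s₀ d.symm)
    (fun d => by
      simp only [SimpleGraph.Dart.symm_symm, e, SimpleGraph.Dart.edge_symm]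
      ring)
    (fun v => by
      have h₁ : ∀ d : G.graph.Dart, s₀ d.symm = s₀ (G.rot d)
          + (if G.rot d = p.src then 1 else 0) + (if G.rot d = p.tgt then 1 else 0) := by
        intro d
        rw [rot_eq, hs₀]
        generalize (if G.next d.symm = p.src then (1 : ZMod 2) else 0) = y
        generalize (if G.next d.symm = p.tgt then (1 : ZMod 2) else 0) = z
        linear_combination -(CharTwo.add_self_eq_zero y) - (CharTwo.add_self_eq_zero z)
      have h₂ : (∑ d : G.graph.Dart with d.fst = v, e d)
          = (if p.src.fst = v then 1 else 0) + (if p.tgt.fst = v then 1 else 0) := by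
        rw [← sum_dart_count_edges p.walk v]
        refine Finset.sum_congr rfl fun d _ => ?_
        rw [count_edges_eq_ite p.isPath.isTrail]
        exact if_congr Iff.rfl rfl rfl
      have h₃ : ∀ a : G.graph.Dart, (∑ d : G.graph.Dart with d.fst = v,
          if d = a then (1 : ZMod 2) else 0) = if a.fst = v then 1 else 0 := by
        intro a
        rw [Finset.sum_ite_eq' (Finset.univ.filter fun d : G.graph.Dart => d.fst = v) a]
        simp
      simp only [h₁, Finset.sum_add_distrib, h₂, G.sum_rot s₀,
        G.sum_rot fun d => if d = p.src then (1 : ZMod 2) else 0,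
        G.sum_rot fun d => if d = p.tgt then (1 : ZMod 2) else 0, h₃]
      generalize (∑ d : G.graph.Dart with d.fst = v, s₀ d) = y
      generalize (if p.src.fst = v then (1 : ZMod 2) else 0) = z
      generalize (if p.tgt.fst = v then (1 : ZMod 2) else 0) = t
      linear_combination CharTwo.add_self_eq_zero y + CharTwo.add_self_eq_zero z
        + CharTwo.add_self_eq_zero t)
  have hxo : ∀ d, G.IsOuter d → x d = x p.src := by
    intro d hd
    obtain ⟨n, rfl⟩ := Equiv.Perm.SameCycle.exists_nat_pow_eq (p.src_outer.symm.trans hd)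
    clear hd
    induction n with
    | zero => rfl
    | succ n ih => rw [pow_succ', Equiv.Perm.mul_apply, ← ih]; exact hx _
  have two : ∀ a : ZMod 2, a = 0 ∨ a = 1 := by decide
  -- As `x` is constant on the external walk, adding `x p.src` makes `s` agree with `s₀` there.
  let s : G.graph.Dart → ZMod 2 := fun d => x d + x p.src + s₀ d
  have hs : ∀ d, s d + s d.symm = e d := by
    intro d
    simp only [s]
    linear_combination hxe d + CharTwo.add_self_eq_zero (x p.src)
      + CharTwo.add_self_eq_zero (s₀ d) + CharTwo.add_self_eq_zero (s₀ d.symm)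
  refine ⟨{d | s d = 1}, fun d hd => ?_, fun d hd => ?_, fun d hd => ?_, fun d hd => ?_⟩
  · have h : s (G.next d) = s d := by
      simp only [Set.mem_insert_iff, Set.mem_singleton_iff, not_or] at hd
      simp [s, hx, hs₀, hd.1, hd.2]
    simp [h]
  · have h := hs d
    simp only [e, hd, if_false] at h
    simp [CharTwo.add_eq_zero.1 h]
  · have h := hs d
    simp only [e, hd, if_true] at h
    simp only [Set.mem_ofPred_eq]
    rcases two (s d) with h₁ | h₁ <;> rcases two (s d.symm) with h₂ | h₂ <;>
      simp_all
  · simp [s, hxo d hd, CharTwo.add_self_eq_zero, s₀]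

/-- A simple path, closed up through the external face, has at most two sides. -/
theorem joined_src_or_joined_tgt [Finite V] (d : G.graph.Dart) :
    G.Joined p.edges {p.src, p.tgt} p.src d ∨ G.Joined p.edges {p.src, p.tgt} p.tgt d := by
  have : Finite G.graph.Dart := finite_dart
  have arc : ∀ (a b : G.graph.Dart), (∀ c, c ∈ ({p.src, p.tgt} : Set G.graph.Dart) →
      c = a ∨ c = b) → ∀ c ∈ orbitArc G.next a b, G.Joined p.edges {p.src, p.tgt} a c := by
    rintro a b hK _ ⟨n, rfl, hn⟩
    induction n with
    | zero => exact Joined.refl _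
    | succ n ih =>
      have h := hn (n + 1) le_rfl
      rw [pow_succ', Equiv.Perm.mul_apply] at h ⊢
      by_cases ha : G.next ((G.next ^ n) a) = a
      · rw [ha]
        exact Joined.refl _
      · exact (ih fun m hm => hn m (hm.trans n.le_succ)).trans
          (Joined.next fun hc => (hK _ hc).elim ha h)
  -- The union of the two classes is closed under `next` even at the blocks, since the dart before
  -- one terminal is joined to the other along the external walk. Its boundary thus lies on the
  -- path, so it contains everything.
  refine mem_of_boundary_isPath (X := {d | G.Joined p.edges {p.src, p.tgt} p.src d ∨
    G.Joined p.edges {p.src, p.tgt} p.tgt d}) (fun d => ?_) p.isPath (fun d hd => ?_)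
    (Or.inl (Joined.refl p.src))
  · by_cases h₁ : G.next d = p.src
    · refine iff_of_true (Or.inl (h₁ ▸ Joined.refl _)) (Or.inr (arc p.tgt p.src ?_ d
        (mem_orbitArc_of_apply_eq_right p.src_ne_tgt.symm p.sameCycle.symm h₁)))
      rintro c (rfl | rfl) <;> simp
    · by_cases h₂ : G.next d = p.tgt
      · refine iff_of_true (Or.inr (h₂ ▸ Joined.refl _)) (Or.inl (arc p.src p.tgt ?_ d
          (mem_orbitArc_of_apply_eq_right p.src_ne_tgt p.sameCycle h₂)))
        rintro c (rfl | rfl) <;> simp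
      · have h : G.Joined p.edges {p.src, p.tgt} d (G.next d) := Joined.next (by simp [h₁, h₂])
        exact or_congr ⟨fun h' => h'.trans h.symm, fun h' => h'.trans h⟩
          ⟨fun h' => h'.trans h.symm, fun h' => h'.trans h⟩
  · have h : G.Joined p.edges {p.src, p.tgt} d d.symm := Joined.cross hd
    exact or_congr ⟨fun h' => h'.trans h.symm, fun h' => h'.trans h⟩
      ⟨fun h' => h'.trans h.symm, fun h' => h'.trans h⟩

theorem isOuter_of_mem_gamma {d : G.graph.Dart} (hd : d ∈ p.gamma) : G.IsOuter d := by
  obtain ⟨n, rfl, -⟩ := hd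
  exact p.src_outer.trans ⟨n, by simp⟩

/-- The side from `exists_side` is a union of classes that contains γ and misses `tgt`. There being
at most two classes, it is the class of `src`. -/
theorem exists_side_inside [Finite V] :
    (∀ d, G.next d ∉ ({p.src, p.tgt} : Set G.graph.Dart) →
      (G.next d ∈ p.inside ↔ d ∈ p.inside)) ∧
    (∀ d : G.graph.Dart, d.edge ∉ p.edges → (d.symm ∈ p.inside ↔ d ∈ p.inside)) ∧
    (∀ d : G.graph.Dart, d.edge ∈ p.edges → (d.symm ∈ p.inside ↔ d ∉ p.inside)) ∧
    ∀ d, G.IsOuter d → (d ∈ p.inside ↔ d ∈ p.gamma) := by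
  obtain ⟨X, hX⟩ := p.exists_side
  suffices h : p.inside = X by rwa [h]
  ext d
  constructor
  · rintro ⟨c, hc, h⟩
    exact (h.mem_iff hX.1 hX.2.1).1 ((hX.2.2.2 c (p.isOuter_of_mem_gamma hc)).2 hc)
  · intro hd
    rcases p.joined_src_or_joined_tgt d with h | h
    · exact ⟨_, p.src_mem_gamma, h⟩
    · exact absurd ((hX.2.2.2 _ p.tgt_outer).1 ((h.mem_iff hX.1 hX.2.1).2 hd))
        p.tgt_notMem_gamma

variable [Finite V] {p} {d d' : G.graph.Dart}

theorem next_mem_inside_iff (ha : G.next d ≠ p.src) (hb : G.next d ≠ p.tgt) :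
    G.next d ∈ p.inside ↔ d ∈ p.inside :=
  p.exists_side_inside.1 d (by simp [ha, hb])

theorem symm_mem_inside_iff (h : d.edge ∉ p.edges) : d.symm ∈ p.inside ↔ d ∈ p.inside :=
  p.exists_side_inside.2.1 d h

theorem symm_mem_inside_iff_notMem (h : d.edge ∈ p.edges) : d.symm ∈ p.inside ↔ d ∉ p.inside :=
  p.exists_side_inside.2.2.1 d h

theorem mem_inside_iff_of_isOuter (h : G.IsOuter d) : d ∈ p.inside ↔ d ∈ p.gamma :=
  p.exists_side_inside.2.2.2 d h

theorem joined_of_mem_inside_iff (h : d ∈ p.inside ↔ d' ∈ p.inside) :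
    G.Joined p.edges {p.src, p.tgt} d d' := by
  have hiff := p.exists_side_inside
  have hsrc : ∀ {d}, G.Joined p.edges {p.src, p.tgt} p.src d → d ∈ p.inside := fun h =>
    ⟨_, p.src_mem_gamma, h⟩
  have htgt : ∀ {d}, G.Joined p.edges {p.src, p.tgt} p.tgt d → d ∉ p.inside := fun h hd =>
    p.tgt_notMem_gamma ((mem_inside_iff_of_isOuter p.tgt_outer).1
      ((h.mem_iff hiff.1 hiff.2.1).2 hd))
  rcases p.joined_src_or_joined_tgt d with h₁ | h₁ <;>
    rcases p.joined_src_or_joined_tgt d' with h₂ | h₂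
  · exact h₁.symm.trans h₂
  · exact absurd (h.1 (hsrc h₁)) (htgt h₂)
  · exact absurd (h.2 (hsrc h₂)) (htgt h₁)
  · exact h₁.symm.trans h₂

end TerminalPath

end PlaneGraph

/-! ### Ends of edge sets on simple paths -/

section Walks

variable {V : Type*} {G : SimpleGraph V} {u v : V}

theorem exists_eq_append_cons_of_mem_edges {w : G.Walk u v} {e : Sym2 V} (he : e ∈ w.edges) :
    ∃ (a b : V) (h : G.Adj a b) (w₁ : G.Walk u a) (w₂ : G.Walk b v),
      w = w₁.append (SimpleGraph.Walk.cons h w₂) ∧ s(a, b) = e := by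
  induction w with
  | nil => simp at he
  | @cons x y z h p ih =>
    rw [SimpleGraph.Walk.edges_cons, List.mem_cons] at he
    rcases he with rfl | he
    · exact ⟨x, y, h, .nil, p, rfl, rfl⟩
    · obtain ⟨a, b, h', w₁, w₂, rfl, rfl⟩ := ih he
      exact ⟨a, b, h', .cons h w₁, w₂, rfl, rfl⟩

theorem notMem_support_of_isPath_append {a b : V} {h : G.Adj a b} {w₁ : G.Walk u a}
    {w₂ : G.Walk b v} (hw : (w₁.append (SimpleGraph.Walk.cons h w₂)).IsPath) {x : V}
    (hx : x ∈ w₁.support) : x ∉ w₂.support := by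
  have := hw.support_nodup
  rw [SimpleGraph.Walk.support_append, SimpleGraph.Walk.support_cons, List.tail_cons] at this
  exact fun hx' => List.disjoint_of_nodup_append this hx hx'

theorem mem_support_of_mem_mem_edges {w : G.Walk u v} {e : Sym2 V} {x : V} (he : e ∈ w.edges)
    (hx : x ∈ e) : x ∈ w.support := by
  induction e with
  | _ a b =>
    rcases Sym2.mem_iff.1 hx with rfl | rfl
    · exact w.fst_mem_support_of_mem_edges he
    · exact w.snd_mem_support_of_mem_edges he

/-- A nonempty set of edges of a simple path has two ends. -/
theorem exists_isExtremal_of_isPath {w : G.Walk u v} (hw : w.IsPath) {B : Set (Sym2 V)}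
    (hB : ∃ e ∈ w.edges, e ∈ B) : ∃ x x' e e', x ≠ x' ∧
      IsExtremal (B ∩ {e | e ∈ w.edges}) x e ∧ IsExtremal (B ∩ {e | e ∈ w.edges}) x' e' := by
  induction w with
  | nil => simp at hB
  | @cons a b c h p ih =>
    rw [SimpleGraph.Walk.cons_isPath_iff] at hw
    have hap : ∀ e ∈ p.edges, a ∉ e := fun e he ha => hw.2 (mem_support_of_mem_mem_edges he ha)
    have hedges : ∀ e, e ∈ (SimpleGraph.Walk.cons h p).edges ↔ e = s(a, b) ∨ e ∈ p.edges :=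
      fun e => by simp
    have hleft : s(a, b) ∈ B →
        IsExtremal (B ∩ {e | e ∈ (SimpleGraph.Walk.cons h p).edges}) a s(a, b) := fun hab =>
      ⟨⟨hab, (hedges _).2 (Or.inl rfl)⟩, by simp, fun e he hae =>
        ((hedges e).1 he.2).resolve_right fun h => hap e h hae⟩
    have hright : ∀ x e, IsExtremal (B ∩ {e | e ∈ p.edges}) x e → (s(a, b) ∈ B → x ≠ b) →
        IsExtremal (B ∩ {e | e ∈ (SimpleGraph.Walk.cons h p).edges}) x e := by
      intro x e hx hxb
      refine ⟨⟨hx.1.1, (hedges _).2 (Or.inr hx.1.2)⟩, hx.2.1, fun e' he' hxe' => ?_⟩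
      rcases (hedges e').1 he'.2 with rfl | h'
      · rcases Sym2.mem_iff.1 hxe' with rfl | rfl
        · exact absurd hx.2.1 (hap e hx.1.2)
        · exact absurd rfl (hxb he'.1)
      · exact hx.2.2 e' ⟨he'.1, h'⟩ hxe'
    by_cases hp : ∃ e ∈ p.edges, e ∈ B
    · obtain ⟨x, x', e, e', hne, hx, hx'⟩ := ih hw.1 hp
      by_cases hab : s(a, b) ∈ B
      · have ha : ∀ y f, IsExtremal (B ∩ {e | e ∈ p.edges}) y f → a ≠ y := by
          rintro _ f hy rfl
          exact hap f hy.1.2 hy.2.1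
        -- The new edge is extremal at `a`. It can spoil an old end only at `b`, and at most one of
        -- the two old ends is there.
        by_cases hxb : x = b
        · exact ⟨a, x', _, e', ha x' e' hx', hleft hab,
            hright x' e' hx' fun _ h => hne (hxb.trans h.symm)⟩
        · exact ⟨a, x, _, e, ha x e hx, hleft hab, hright x e hx fun _ => hxb⟩
      · exact ⟨x, x', e, e', hne, hright x e hx fun h => absurd h hab,
          hright x' e' hx' fun h => absurd h hab⟩
    · obtain ⟨e, he, heB⟩ := hB
      have hab : s(a, b) ∈ B := by
        rcases (hedges e).1 he with rfl | he
        · exact heB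
        · exact absurd ⟨e, he, heB⟩ hp
      refine ⟨a, b, _, _, h.ne, hleft hab, ⟨⟨hab, (hedges _).2 (Or.inl rfl)⟩, by simp,
        fun e' he' _ => ((hedges e').1 he'.2).resolve_right fun h' => hp ⟨e', h', he'.1⟩⟩⟩

/-- An edge set that, outside a simple path `w`, stays within a vertex set avoided by an initial
part of `w`, has an end on that initial part. -/
theorem exists_isExtremal_of_append {a b : V} {h : G.Adj a b} {w₁ : G.Walk u a}
    {w₂ : G.Walk b v} (hw : (w₁.append (SimpleGraph.Walk.cons h w₂)).IsPath)
    {B : Set (Sym2 V)} (hab : s(a, b) ∈ B) {S : Set V} (hS : ∀ x ∈ w₁.support, x ∉ S)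
    (hB : ∀ e ∈ B, e ∉ (w₁.append (SimpleGraph.Walk.cons h w₂)).edges → ∀ x ∈ e, x ∈ S) :
    ∃ x e, x ∉ S ∧ IsExtremal B x e := by
  -- Of the two ends of `B` on `w₀`, one is not `b` and hence lies on `w₁`. No edge of `B` off `w₀`
  -- reaches it: such an edge stays in `S` or lies on `w₂`.
  set w₀ := w₁.append (SimpleGraph.Walk.cons h .nil)
  have hw₀ : w₀.append w₂ = w₁.append (SimpleGraph.Walk.cons h w₂) := by
    rw [← SimpleGraph.Walk.append_assoc]
    rfl
  have hpath : w₀.IsPath := by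
    rw [← hw₀] at hw
    exact hw.of_append_left
  obtain ⟨x, x', e, e', hne, hx, hx'⟩ := exists_isExtremal_of_isPath (B := B) hpath
    ⟨s(a, b), by simp [w₀], hab⟩
  have key : ∀ y f, y ≠ b → IsExtremal (B ∩ {e | e ∈ w₀.edges}) y f →
      y ∉ S ∧ IsExtremal B y f := by
    intro y f hyb hy
    have hys : y ∈ w₁.support := by
      have := mem_support_of_mem_mem_edges hy.1.2 hy.2.1
      simpa [w₀, SimpleGraph.Walk.support_append, hyb] using this
    refine ⟨hS y hys, hy.1.1, hy.2.1, fun e' he' hye' => hy.2.2 e' ⟨he', ?_⟩ hye'⟩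
    by_contra hew
    refine hS y hys (hB e' he' (fun hmem => ?_) y hye')
    rw [← hw₀, SimpleGraph.Walk.edges_append, List.mem_append] at hmem
    rcases hmem with hmem | hmem
    · exact hew hmem
    · exact notMem_support_of_isPath_append hw hys (mem_support_of_mem_mem_edges hmem hye')
  by_cases hxb : x = b
  · exact ⟨x', e', key x' e' (fun h => hne (hxb.trans h.symm)) hx'⟩
  · exact ⟨x, e, key x e hxb hx⟩

end Walks

/-! ### Relative position of single-touch paths -/

namespace PlaneGraph.TerminalPath

variable {V : Type*} {G : PlaneGraph V} {p q : G.TerminalPath}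

theorem SingleTouch.symm (h : p.SingleTouch q) : q.SingleTouch p := by
  unfold SingleTouch at *
  rwa [inf_comm]

/-- A path that touches another one in a single subpath avoids it before or after each edge
that is not common to both. -/
theorem SingleTouch.avoids (h : p.SingleTouch q) {a b : V} {hab : G.graph.Adj a b}
    {w₁ : G.graph.Walk p.src.fst a} {w₂ : G.graph.Walk b p.tgt.fst}
    (hw : p.walk = w₁.append (SimpleGraph.Walk.cons hab w₂)) (he : s(a, b) ∉ q.edges) :
    (∀ x ∈ w₁.support, x ∉ q.walk.support) ∨ ∀ x ∈ w₂.support, x ∉ q.walk.support := by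
  by_contra! hcon
  obtain ⟨⟨x, hx, hxq⟩, y, hy, hyq⟩ := hcon
  have hpath := p.isPath
  rw [hw] at hpath
  have hmem : ∀ z, z ∈ (p.walk.toSubgraph ⊓ q.walk.toSubgraph).verts ↔
      z ∈ p.walk.support ∧ z ∈ q.walk.support := fun z => by simp
  have hxp : x ∈ p.walk.support := by
    rw [hw, SimpleGraph.Walk.mem_support_append_iff]
    exact Or.inl hx
  have hyp : y ∈ p.walk.support := by
    rw [hw, SimpleGraph.Walk.mem_support_append_iff, SimpleGraph.Walk.support_cons]
    exact Or.inr (List.mem_cons_of_mem _ hy)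
  rcases h with h | ⟨c, d, r, -, hr⟩
  · have := (hmem x).2 ⟨hxp, hxq⟩
    rw [h] at this
    exact this
  · have hr' : ∀ e ∈ r.edges, e ∈ p.walk.edges ∧ e ∈ q.walk.edges := by
      intro e he
      rw [← SimpleGraph.Walk.mem_edges_toSubgraph, hr, SimpleGraph.Subgraph.edgeSet_inf] at he
      exact ⟨(SimpleGraph.Walk.mem_edges_toSubgraph _).1 he.1,
        (SimpleGraph.Walk.mem_edges_toSubgraph _).1 he.2⟩
    have hxr : x ∈ r.support := by
      rw [← SimpleGraph.Walk.mem_verts_toSubgraph, hr]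
      exact (hmem x).2 ⟨hxp, hxq⟩
    have hyr : y ∈ r.support := by
      rw [← SimpleGraph.Walk.mem_verts_toSubgraph, hr]
      exact (hmem y).2 ⟨hyp, hyq⟩
    clear hr
    -- Within `p`, only the edge `s(a, b)` links `w₁` to `w₂`. The common subpath `r` avoids it, so
    -- it cannot contain both `x` and `y`.
    have hside : ∀ z z', s(z, z') ∈ p.walk.edges → s(z, z') ≠ s(a, b) →
        z ∈ w₁.support → z' ∈ w₁.support := by
      intro z z' hz hne hz₁
      rw [hw, SimpleGraph.Walk.edges_append, SimpleGraph.Walk.edges_cons, List.mem_append,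
        List.mem_cons] at hz
      rcases hz with hz | hz | hz
      · exact w₁.snd_mem_support_of_mem_edges hz
      · exact absurd hz hne
      · exact absurd (w₂.fst_mem_support_of_mem_edges hz)
          (notMem_support_of_isPath_append hpath hz₁)
    have hall : ∀ z ∈ r.support, z ∈ w₁.support ↔ c ∈ w₁.support := by
      clear hxr hyr
      induction r with
      | nil => simp
      | @cons c c' d hcc r ih =>
        intro z hz
        rw [SimpleGraph.Walk.support_cons, List.mem_cons] at hz
        rcases hz with rfl | hz
        · rfl
        · rw [ih (fun e he => hr' e (List.mem_cons_of_mem _ he)) z hz]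
          have hc := hr' s(c, c') (by simp)
          have hne : s(c, c') ≠ s(a, b) := fun h => he (h ▸ hc.2)
          exact ⟨hside c' c (Sym2.eq_swap ▸ hc.1) (Sym2.eq_swap ▸ hne), hside c c' hc.1 hne⟩
    exact notMem_support_of_isPath_append hpath ((hall y hyr).2 ((hall x hxr).1 hx)) hy

/-- One of the two parts of `p` next to `e` avoids `q`; edges of `B` off `p` lie on `q` and so
cannot touch that part. -/
theorem SingleTouch.exists_isExtremal_notMem (h : p.SingleTouch q) {B : Set (Sym2 V)}
    (hB : B ⊆ p.edges ∪ q.edges) {e : Sym2 V} (heB : e ∈ B) (hep : e ∈ p.edges)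
    (heq : e ∉ q.edges) : ∃ x e', x ∉ q.walk.support ∧ IsExtremal B x e' := by
  obtain ⟨a, b, hab, w₁, w₂, hw, rfl⟩ := exists_eq_append_cons_of_mem_edges hep
  have hpath := p.isPath
  have hB' : ∀ e ∈ B, e ∉ p.walk.edges → ∀ x ∈ e, x ∈ {x | x ∈ q.walk.support} :=
    fun e he hep x hx => mem_support_of_mem_mem_edges ((hB he).resolve_left hep) hx
  rcases h.avoids hw heq with h | h
  · rw [hw] at hpath hB'
    exact exists_isExtremal_of_append hpath heB h hB'
  · have hrev : p.walk.reverse = w₂.reverse.append (.cons hab.symm w₁.reverse) := by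
      rw [hw, SimpleGraph.Walk.reverse_append, SimpleGraph.Walk.reverse_cons,
        ← SimpleGraph.Walk.append_assoc]
      rfl
    rw [← SimpleGraph.Walk.isPath_reverse_iff, hrev] at hpath
    refine exists_isExtremal_of_append hpath (Sym2.eq_swap ▸ heB)
      (S := {x | x ∈ q.walk.support}) (fun x hx => h x (by simpa using hx)) fun e he hep => ?_
    rw [← hrev] at hep
    exact hB' e he (by simpa using hep)

/-- A nonempty edge set within the union of two single-touch paths has two ends. -/
theorem SingleTouch.exists_isExtremal (h : p.SingleTouch q) {B : Set (Sym2 V)}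
    (hB : B ⊆ p.edges ∪ q.edges) (hne : B.Nonempty) :
    ∃ x x' e e', x ≠ x' ∧ IsExtremal B x e ∧ IsExtremal B x' e' := by
  have path : ∀ r : G.TerminalPath, B ⊆ r.edges →
      ∃ x x' e e', x ≠ x' ∧ IsExtremal B x e ∧ IsExtremal B x' e' := by
    intro r hr
    obtain ⟨e, he⟩ := hne
    have := exists_isExtremal_of_isPath r.isPath ⟨e, hr he, he⟩
    rwa [show B ∩ {e | e ∈ r.walk.edges} = B from Set.inter_eq_left.2 hr] at this
  by_cases hp : B ⊆ p.edges
  · exact path p hp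
  by_cases hq : B ⊆ q.edges
  · exact path q hq
  obtain ⟨e₁, h₁, h₁p⟩ := Set.not_subset.1 hp
  obtain ⟨e₂, h₂, h₂q⟩ := Set.not_subset.1 hq
  obtain ⟨x, e, hx, hxe⟩ := h.exists_isExtremal_notMem hB h₂ ((hB h₂).resolve_right h₂q) h₂q
  obtain ⟨x', e', hx', hxe'⟩ := h.symm.exists_isExtremal_notMem (Set.union_comm _ _ ▸ hB) h₁
    ((hB h₁).resolve_left h₁p) h₁p
  -- One end is off `q`, the other off `p`; a common value would lie on an edge of `B`, hence on one
  -- of the two paths.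
  refine ⟨x, x', e, e', ?_, hxe, hxe'⟩
  rintro rfl
  rcases hB hxe.1 with h | h
  · exact hx' (mem_support_of_mem_mem_edges h hxe.2.1)
  · exact hx (mem_support_of_mem_mem_edges h hxe.2.1)

/-- Along the external walk, membership in γ changes only at `src` and `tgt`, so γ determines both.
-/
theorem eq_of_gamma_eq [Finite V] (h : p.gamma = q.gamma) : p.src = q.src ∧ p.tgt = q.tgt := by
  obtain ⟨a, ha⟩ := G.next.surjective p.src
  obtain ⟨b, hb⟩ := G.next.surjective p.tgt
  constructor
  · by_contra hne
    have h₁ := (next_mem_gamma_iff (p := q) (d := a) (ha ▸ hne)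
      fun h' => q.tgt_notMem_gamma (h ▸ h' ▸ ha ▸ p.src_mem_gamma)).1
      (ha ▸ h ▸ p.src_mem_gamma)
    exact notMem_gamma_of_next_eq_src ha (h ▸ h₁)
  · by_contra hne
    have h₁ := (next_mem_gamma_iff (p := q) (d := b)
      (fun h' => p.tgt_notMem_gamma (h ▸ hb ▸ h' ▸ q.src_mem_gamma)) (hb ▸ hne)).2
      (h ▸ mem_gamma_of_next_eq_tgt hb)
    exact p.tgt_notMem_gamma (h ▸ hb ▸ h₁)

theorem edge_notMem_of_fst_notMem {d : G.graph.Dart} (h : d.fst ∉ q.walk.support) : d.edge ∉ q.edges :=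
  fun h' => h (q.walk.fst_mem_support_of_mem_edges h')

section

variable [Finite V] {d d' : G.graph.Dart}

/-- Rotating about a vertex off `q` crosses no edge of `q` and meets no terminal of `q`. -/
theorem mem_inside_iff_of_fst_notMem (h : d.fst ∉ q.walk.support) (hd : d'.fst = d.fst) :
    d ∈ q.inside ↔ d' ∈ q.inside := by
  refine (G.rot_invariant (g := fun d => d ∈ q.inside) (v := d.fst) (fun d'' hd'' => ?_) rfl
    hd).to_iff
  have hf := (G.fst_next_symm d'').trans hd''
  rw [rot_eq, eq_iff_iff, next_mem_inside_iff (fun h' => h ?_) (fun h' => h ?_),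
    symm_mem_inside_iff (edge_notMem_of_fst_notMem (hd''.symm ▸ h))]
  · rw [← hf, h']
    exact q.walk.start_mem_support
  · rw [← hf, h']
    exact q.walk.end_mem_support

theorem mem_inside_iff_of_walk {u v : V} (w : G.graph.Walk u v)
    (hw : ∀ x ∈ w.support, x ∉ q.walk.support) {d d' : G.graph.Dart} (hd : d.fst = u)
    (hd' : d'.fst = v) : d ∈ q.inside ↔ d' ∈ q.inside := by
  induction w generalizing d with
  | nil =>
    refine mem_inside_iff_of_fst_notMem (hw _ ?_) (hd'.trans hd.symm)
    simp [hd]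
  | @cons a b c h p ih =>
    have ha : a ∉ q.walk.support := hw a (by simp)
    rw [mem_inside_iff_of_fst_notMem (d := d) (d' := ⟨(a, b), h⟩) (hd.symm ▸ ha) hd.symm,
      ← symm_mem_inside_iff (edge_notMem_of_fst_notMem ha)]
    exact ih (fun x hx => hw x (List.mem_cons_of_mem _ hx)) rfl hd'

/-- By single touch, `p` can be followed from the edge to one of its terminals without meeting `q`,
hence without changing sides. -/
theorem mem_inside_iff_terminal (h : p.SingleTouch q) (hp : d.edge ∈ p.edges)
    (hq : d.edge ∉ q.edges) :
    (p.src.fst ∉ q.walk.support ∧ (d ∈ q.inside ↔ p.src ∈ q.inside)) ∨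
      p.tgt.fst ∉ q.walk.support ∧ (d ∈ q.inside ↔ p.tgt ∈ q.inside) := by
  obtain ⟨a, b, hab, w₁, w₂, hw, he⟩ := exists_eq_append_cons_of_mem_edges hp
  set d₀ : G.graph.Dart := ⟨(a, b), hab⟩ with hd₀
  have hq₀ : d₀.edge ∉ q.edges := fun h' => hq (he ▸ h')
  have hd : (d ∈ q.inside ↔ d₀ ∈ q.inside) ∧ (d ∈ q.inside ↔ d₀.symm ∈ q.inside) := by
    have h₀ := symm_mem_inside_iff (p := q) hq₀
    rcases (SimpleGraph.dart_edge_eq_iff d d₀).1 he.symm with rfl | rfl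
    · exact ⟨Iff.rfl, h₀.symm⟩
    · exact ⟨h₀, Iff.rfl⟩
  rcases h.avoids hw hq₀ with h | h
  · exact Or.inl ⟨h _ w₁.start_mem_support, hd.1.trans (mem_inside_iff_of_walk w₁ h rfl rfl).symm⟩
  · exact Or.inr ⟨h _ w₂.end_mem_support, hd.2.trans (mem_inside_iff_of_walk w₂ h rfl rfl)⟩

/-- The edges of `p` outside `q` are inside `q` if and only if `γ_p` is contained in `γ_q`. -/
theorem mem_inside_iff_gamma_subset (h : p.SingleTouch q)
    (hwf : p.gamma ⊆ q.gamma ∨ q.gamma ⊆ p.gamma ∨ Disjoint p.gamma q.gamma)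
    (hp : d.edge ∈ p.edges) (hq : d.edge ∉ q.edges) :
    d ∈ q.inside ↔ p.gamma ⊆ q.gamma := by
  -- The darts just before the terminals: `a` is not in γ_p and `b` is. At a terminal off `q`, the
  -- step from the preceding dart neither enters nor leaves γ_q, which excludes γ_q ⊆ γ_p or
  -- disjointness as needed.
  obtain ⟨a, ha⟩ := G.next.surjective p.src
  obtain ⟨b, hb⟩ := G.next.surjective p.tgt
  have hap := notMem_gamma_of_next_eq_src ha
  have hbp := mem_gamma_of_next_eq_tgt hb
  have step : ∀ t c : G.graph.Dart, t.fst ∉ q.walk.support → G.next c = t →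
      (t ∈ q.gamma ↔ c ∈ q.gamma) := by
    rintro _ c ht rfl
    refine next_mem_gamma_iff (fun h => ht ?_) (fun h => ht ?_)
    · rw [h]
      exact q.walk.start_mem_support
    · rw [h]
      exact q.walk.end_mem_support
  rcases mem_inside_iff_terminal h hp hq with ⟨hs, hd⟩ | ⟨hs, hd⟩
  · rw [hd, mem_inside_iff_of_isOuter p.src_outer]
    refine ⟨fun hmem => ?_, fun hsub => hsub p.src_mem_gamma⟩
    rcases hwf with hwf | hwf | hwf
    · exact hwf
    · exact absurd (hwf ((step _ a hs ha).1 hmem)) hap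
    · exact absurd hmem (Set.disjoint_left.1 hwf p.src_mem_gamma)
  · rw [hd, mem_inside_iff_of_isOuter p.tgt_outer]
    refine ⟨fun hmem => ?_, fun hsub => (step _ b hs hb).2 (hsub hbp)⟩
    rcases hwf with hwf | hwf | hwf
    · exact hwf
    · exact absurd (hwf hmem) p.tgt_notMem_gamma
    · exact absurd ((step _ b hs hb).1 hmem) (Set.disjoint_left.1 hwf hbp)

/-- Paths with disjoint parts of the external walk have disjoint insides. -/
theorem disjoint_inside (h : p.SingleTouch q) (hpq : Disjoint p.gamma q.gamma) :
    Disjoint p.inside q.inside := by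
  refine Set.disjoint_left.2 fun d hd => ?_
  -- Inside `p` the side of `q` never changes: an edge of `q` there would force γ_q ⊆ γ_p. At
  -- `p.src` that side is the outer one.
  let r : G.graph.Dart → G.graph.Dart → Prop := fun x y =>
    (x ∈ p.inside ↔ y ∈ p.inside) ∧ (x ∈ p.inside → (x ∈ q.inside ↔ y ∈ q.inside))
  have hr : Equivalence r := ⟨fun x => ⟨Iff.rfl, fun _ => Iff.rfl⟩,
    fun h => ⟨h.1.symm, fun h' => (h.2 (h.1.2 h')).symm⟩,
    fun h h' => ⟨h.1.trans h'.1, fun hx => (h.2 hx).trans (h'.2 (h.1.1 hx))⟩⟩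
  have hsrc := (mem_inside_iff_of_isOuter p.src_outer).2 p.src_mem_gamma
  have hj : r p.src d := Joined.rel_of_equivalence hr (fun x hx => ?_) (fun x hx => ?_)
    (joined_of_mem_inside_iff (p := p) (iff_of_true hsrc hd))
  · rw [← hj.2 hsrc, mem_inside_iff_of_isOuter p.src_outer]
    exact Set.disjoint_left.1 hpq p.src_mem_gamma
  · simp only [Set.mem_insert_iff, Set.mem_singleton_iff, not_or] at hx
    have hp := next_mem_inside_iff hx.1 hx.2
    refine ⟨hp.symm, fun hxp => ?_⟩
    have hin := hp.2 hxp
    refine (next_mem_inside_iff (fun hs => ?_) (fun ht => ?_)).symm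
    · rw [hs, mem_inside_iff_of_isOuter q.src_outer] at hin
      exact Set.disjoint_left.1 hpq hin q.src_mem_gamma
    · have hxo : G.IsOuter x := isOuter_next_iff.1 (ht ▸ q.tgt_outer)
      exact Set.disjoint_left.1 hpq ((mem_inside_iff_of_isOuter hxo).1 hxp)
        (mem_gamma_of_next_eq_tgt ht)
  · refine ⟨(symm_mem_inside_iff hx).symm, fun hxp => ?_⟩
    by_cases hxq : x.edge ∈ q.edges
    · have hsub := (mem_inside_iff_gamma_subset h.symm (Or.inr (Or.inr hpq.symm)) hxq hx).1 hxp
      exact absurd q.src_mem_gamma (Set.disjoint_left.1 hpq (hsub q.src_mem_gamma))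
    · exact (symm_mem_inside_iff hxq).symm

end

end PlaneGraph.TerminalPath

/-! ### Faces of the union and induction along the genealogy tree -/

open PlaneGraph PlaneGraph.TerminalPath

variable {V : Type*} {G : PlaneGraph V}

variable {ι : Type*} {P : ι → G.TerminalPath} {root : ι}

theorem edges_subset_unionEdges (i : ι) : (P i).edges ⊆ unionEdges P :=
  Set.subset_iUnion (fun i => (P i).edges) i

variable [Finite V]

/-- A subgraph is acyclic if the dual graph stays connected without its edges. -/
theorem coe_isAcyclic_of_joined {H : G.graph.Subgraph}
    (hH : ∀ d, G.Joined H.edgeSet ∅ G.outer d) : H.coe.IsAcyclic := by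
  have : Finite G.graph.Dart := finite_dart
  have := Fintype.ofFinite G.graph.Dart
  have := Classical.decEq V
  intro v c hc
  have hw := hc.map (f := H.hom) Subtype.val_injective
  have hedge : ∀ e ∈ (c.map H.hom).edges, e ∈ H.edgeSet := by
    intro e he
    rw [SimpleGraph.Walk.edges_map, List.mem_map] at he
    obtain ⟨e', he', rfl⟩ := he
    have := c.edges_subset_edgeSet he'
    induction e' with
    | _ a b => exact this
  generalize c.map H.hom = w at hw hedge
  -- The faces are two-coloured so that the colour changes exactly across the cycle; dual
  -- connectivity then forces a constant colour.
  obtain ⟨x, hx, hxc⟩ := G.exists_face_coloring (fun d => (w.edges.count d.edge : ZMod 2))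
    (fun d => by simp) (fun v => by
      rw [sum_dart_count_edges]
      exact CharTwo.add_self_eq_zero _)
  have hconst : ∀ d, x G.outer = x d := fun d =>
    PlaneGraph.Joined.rel_of_equivalence (r := fun d d' => x d = x d') ⟨fun _ => rfl, Eq.symm, Eq.trans⟩
      (fun d _ => (hx d).symm) (fun d hd => by
        have := hxc d
        rw [List.count_eq_zero_of_not_mem fun h => hd (hedge _ h), Nat.cast_zero] at this
        exact CharTwo.add_eq_zero.1 this) (hH d)
  obtain ⟨e, he⟩ : ∃ e, e ∈ w.edges := List.exists_mem_of_ne_nil _ fun h =>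
    hw.ne_nil (SimpleGraph.Walk.edges_eq_nil.1 h |>.eq_nil)
  induction e with
  | _ a b =>
    have h := hxc ⟨(a, b), w.adj_of_mem_edges he⟩
    rw [← hconst, ← hconst (SimpleGraph.Dart.symm _), CharTwo.add_self_eq_zero, SimpleGraph.Dart.edge_mk,
      count_edges_eq_ite hw.isTrail, if_pos he] at h
    exact zero_ne_one h

/-- Two darts on the same side of a path lie in one face if that side contains no edge of the
other paths. -/
theorem joined_of_side_empty (i : ι) (t : Prop)
    (ht : ∀ d : G.graph.Dart, d.edge ∈ unionEdges P → d.edge ∉ (P i).edges →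
      ¬(d ∈ (P i).inside ↔ t)) {d d' : G.graph.Dart} (hd : d ∈ (P i).inside ↔ t)
    (hd' : d' ∈ (P i).inside ↔ t) : G.Joined (unionEdges P) ∅ d d' := by
  let r : G.graph.Dart → G.graph.Dart → Prop := fun x y =>
    (x ∈ (P i).inside ↔ y ∈ (P i).inside) ∧
      ((x ∈ (P i).inside ↔ t) → G.Joined (unionEdges P) ∅ x y)
  have hr : Equivalence r := ⟨fun x => ⟨Iff.rfl, fun _ => PlaneGraph.Joined.refl x⟩,
    fun h => ⟨h.1.symm, fun h' => (h.2 (h.1.trans h')).symm⟩,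
    fun h h' => ⟨h.1.trans h'.1, fun hx => (h.2 hx).trans (h'.2 (h.1.symm.trans hx))⟩⟩
  have hj : r d d' := PlaneGraph.Joined.rel_of_equivalence hr (fun x hx => ?_) (fun x hx => ?_)
    (joined_of_mem_inside_iff (p := P i) (hd.trans hd'.symm))
  · exact hj.2 hd
  · simp only [Set.mem_insert_iff, Set.mem_singleton_iff, not_or] at hx
    exact ⟨(next_mem_inside_iff hx.1 hx.2).symm, fun _ => PlaneGraph.Joined.next (Set.notMem_empty _)⟩
  · exact ⟨(symm_mem_inside_iff hx).symm, fun hxt => PlaneGraph.Joined.cross fun hxU => ht x hxU hx hxt⟩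

/-- A bounded face of the union lies on one side of each path. -/
theorem mem_inside_iff_of_joined {d d' : G.graph.Dart}
    (hd : ¬ G.Joined (unionEdges P) ∅ G.outer d) (h : G.Joined (unionEdges P) ∅ d d') (i : ι) :
    d ∈ (P i).inside ↔ d' ∈ (P i).inside := by
  -- Without crossing the union, the side of `P i` can change only at the places of its terminals on
  -- the external walk, which a bounded face does not meet.
  let r : G.graph.Dart → G.graph.Dart → Prop := fun x y =>
    (G.Joined (unionEdges P) ∅ G.outer x ↔ G.Joined (unionEdges P) ∅ G.outer y) ∧
      (¬ G.Joined (unionEdges P) ∅ G.outer x → (x ∈ (P i).inside ↔ y ∈ (P i).inside))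
  have hr : Equivalence r := ⟨fun x => ⟨Iff.rfl, fun _ => Iff.rfl⟩,
    fun h => ⟨h.1.symm, fun h' => (h.2 fun hx => h' (h.1.1 hx)).symm⟩,
    fun h h' => ⟨h.1.trans h'.1, fun hx => (h.2 hx).trans (h'.2 fun hy => hx (h.1.2 hy))⟩⟩
  have hiff : ∀ {x y}, G.Joined (unionEdges P) ∅ x y →
      (G.Joined (unionEdges P) ∅ G.outer x ↔ G.Joined (unionEdges P) ∅ G.outer y) :=
    fun h => ⟨fun h' => h'.trans h, fun h' => h'.trans h.symm⟩
  refine (PlaneGraph.Joined.rel_of_equivalence hr (fun x hx => ?_) (fun x hx => ?_) h).2 hd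
  · have hj : G.Joined (unionEdges P) ∅ x (G.next x) := PlaneGraph.Joined.next hx
    refine ⟨hiff hj, fun hxo => (next_mem_inside_iff (fun hs => ?_) (fun hs => ?_)).symm⟩
    · exact hxo ((joined_outer_of_isOuter (hs ▸ (P i).src_outer)).trans hj.symm)
    · exact hxo ((joined_outer_of_isOuter (hs ▸ (P i).tgt_outer)).trans hj.symm)
  · exact ⟨hiff (PlaneGraph.Joined.cross hx), fun _ =>
      (symm_mem_inside_iff fun h => hx (edges_subset_unionEdges i h)).symm⟩

theorem exists_isChild {i j : ι} (hij : (P j).gamma ⊂ (P i).gamma) :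
    ∃ c, IsChild P c i ∧ (P j).gamma ⊆ (P c).gamma := by
  have : Finite G.graph.Dart := finite_dart
  -- A minimum for `>` is an inclusion-maximal γ strictly below that of `P i`.
  obtain ⟨_, ⟨c, rfl, hjc, hci⟩, hmax⟩ := (wellFounded_gt (α := Set G.graph.Dart)).has_min
    {Γ | ∃ c, (P c).gamma = Γ ∧ (P j).gamma ⊆ Γ ∧ Γ ⊂ (P i).gamma} ⟨_, j, rfl, subset_rfl, hij⟩
  exact ⟨c, ⟨hci, fun ⟨r, hcr, hri⟩ => hmax _ ⟨r, rfl, hjc.trans hcr.subset, hri⟩ hcr⟩, hjc⟩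

namespace IsNCS

theorem gamma_ne (hP : IsNCS P root) {i j : ι} (hij : i ≠ j) : (P i).gamma ≠ (P j).gamma := fun h =>
  hP.distinct i j hij (by
    obtain ⟨h₁, h₂⟩ := eq_of_gamma_eq h
    rw [h₁, h₂])

/-- An edge of `P j` that lies inside `P i` belongs to a descendant of `P i`. -/
theorem gamma_ssubset (hP : IsNCS P root) {i j : ι} {d : G.graph.Dart} (hj : d.edge ∈ (P j).edges)
    (hi : d.edge ∉ (P i).edges) (hd : d ∈ (P i).inside) : (P j).gamma ⊂ (P i).gamma := by
  have hij : j ≠ i := by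
    rintro rfl
    exact hi hj
  exact ((mem_inside_iff_gamma_subset (hP.singleTouch j i hij) (hP.wellFormed j i) hj hi).1
    hd).ssubset_of_ne (hP.gamma_ne hij)

theorem mem_inside (hP : IsNCS P root) {i j : ι} {d : G.graph.Dart} (hj : d.edge ∈ (P j).edges)
    (hi : d.edge ∉ (P i).edges) (hij : (P j).gamma ⊆ (P i).gamma) : d ∈ (P i).inside := by
  have hne : j ≠ i := by
    rintro rfl
    exact hi hj
  exact (mem_inside_iff_gamma_subset (hP.singleTouch j i hne) (hP.wellFormed j i) hj hi).2 hij

/-- Every other path is a descendant of the root, so no edge of the union lies strictly outside the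
root path. That side is a single face, and it contains the dart `tgt` of the external walk. -/
theorem joined_outer_of_notMem_root (hP : IsNCS P root) {d : G.graph.Dart} (hd : d ∉ (P root).inside) :
    G.Joined (unionEdges P) ∅ G.outer d := by
  have htgt : (P root).tgt ∉ (P root).inside := fun h =>
    (P root).tgt_notMem_gamma ((mem_inside_iff_of_isOuter (P root).tgt_outer).1 h)
  refine (joined_outer_of_isOuter (P root).tgt_outer).trans
    (joined_of_side_empty root False (fun x hx hxr h => ?_) (iff_false_intro htgt)
      (iff_false_intro hd))
  obtain ⟨j, hj⟩ := Set.mem_iUnion.1 hx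
  exact h.1 (hP.mem_inside hj hxr (hP.root_max j))

/-- If no smaller path has `d` inside, then all paths with `d` inside are ancestors. -/
theorem gamma_subset_of_minimal (hP : IsNCS P root) {i j : ι} {d : G.graph.Dart} (hi : d ∈ (P i).inside)
    (hmin : ∀ r, d ∈ (P r).inside → ¬ (P r).gamma ⊂ (P i).gamma) (hj : d ∈ (P j).inside) :
    (P i).gamma ⊆ (P j).gamma := by
  by_cases hij : i = j
  · rw [hij]
  rcases hP.wellFormed i j with h | h | h
  · exact h
  · exact absurd (h.ssubset_of_ne (hP.gamma_ne (Ne.symm hij))) (hmin j hj)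
  · exact absurd hj (Set.disjoint_left.1 (disjoint_inside (hP.singleTouch i j hij) h) hi)

end IsNCS

/-- An edge on the lower boundary of a bounded face lies on a child of the upper path. -/
theorem IsNCS.exists_isChild_of_mem_lowerBoundary (hP : IsNCS P root) {i : ι}
    {d : G.graph.Dart} (hd : d ∈ (P i).inside)
    (hmin : ∀ r, d ∈ (P r).inside → ¬ (P r).gamma ⊂ (P i).gamma)
    (ho : ¬ G.Joined (unionEdges P) ∅ G.outer d) {e : Sym2 V}
    (he : e ∈ lowerBoundary P i {d' | G.Joined (unionEdges P) ∅ d d'}) :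
    ∃ c, IsChild P c i ∧ e ∈ (P c).edges := by
  obtain ⟨⟨heU, x, hx, rfl⟩, hei⟩ := he
  obtain ⟨j, hj⟩ := Set.mem_iUnion.1 heU
  have hside := mem_inside_iff_of_joined ho hx
  obtain ⟨c, hc, hjc⟩ := exists_isChild (hP.gamma_ssubset hj hei ((hside i).1 hd))
  refine ⟨c, hc, ?_⟩
  -- Here `c` is the child above `j`. An edge of `P j` off `P c` is inside `P c`, and then so is the
  -- whole face, contradicting minimality of `P i`.
  by_contra hec
  exact hmin c ((hside c).2 (hP.mem_inside hj hec hjc)) hc.1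

/-- The lower boundary of a bounded face is not empty. -/
theorem lowerBoundary_nonempty {d : G.graph.Dart} (i : ι)
    (ho : ¬ G.Joined (unionEdges P) ∅ G.outer d) :
    (lowerBoundary P i {d' | G.Joined (unionEdges P) ∅ d d'}).Nonempty := by
  by_contra hB
  rw [Set.not_nonempty_iff_eq_empty] at hB
  -- If the lower boundary is empty, the boundary of the face lies on the simple path `P i`, so the
  -- face is everything, including `outer`.
  have hf : ∀ x, G.Joined (unionEdges P) ∅ d x → x.edge ∈ unionEdges P → x.edge ∈ (P i).edges := by
    intro x hx hxU
    by_contra hxi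
    have hmem : x.edge ∈ lowerBoundary P i {d' | G.Joined (unionEdges P) ∅ d d'} :=
      ⟨⟨hxU, x, hx, rfl⟩, hxi⟩
    rw [hB] at hmem
    exact hmem
  refine ho (PlaneGraph.Joined.symm (mem_of_boundary_isPath (X := {d' | G.Joined (unionEdges P) ∅ d d'})
    (fun x => ?_) (P i).isPath (fun x hx => ?_) (PlaneGraph.Joined.refl d)))
  · have hj : G.Joined (unionEdges P) ∅ x (G.next x) := PlaneGraph.Joined.next (Set.notMem_empty _)
    exact ⟨fun h => h.trans hj.symm, fun h => h.trans hj⟩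
  · by_cases hxU : x.edge ∈ unionEdges P
    · refine iff_of_false (fun h => hx (x.edge_symm ▸ hf _ h (x.edge_symm.symm ▸ hxU)))
        fun h => hx (hf _ h hxU)
    · have hj : G.Joined (unionEdges P) ∅ x x.symm := PlaneGraph.Joined.cross hxU
      exact ⟨fun h => h.trans hj.symm, fun h => h.trans hj⟩

/-- If all faces are solved, then every face can be joined to the external face without crossing
the paths of a given label. -/
theorem IsBinaryNCS.joined_outer (hP : IsBinaryNCS P root) {k : ℕ} {L : ι → Fin k}
    (hL : ∀ f : Set G.graph.Dart, IsFace P f → IsSolved P L f) (a : Fin k) {A : Set (Sym2 V)}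
    (hA : ∀ e ∈ A, a ∈ edgeLabels P L e) (d : G.graph.Dart) : G.Joined A ∅ G.outer d := by
  have : Finite G.graph.Dart := finite_dart
  have hAU : A ⊆ unionEdges P := fun e he => by
    obtain ⟨i, hi, -⟩ := hA e he
    exact edges_subset_unionEdges i hi
  have key : ∀ (Γ : Set G.graph.Dart) (i : ι), (P i).gamma = Γ → ∀ d ∈ (P i).inside,
      G.Joined A ∅ G.outer d := by
    intro Γ
    induction Γ using WellFoundedLT.induction with
    | ind Γ ih =>
    rintro i rfl d hd
    by_cases ho : G.Joined (unionEdges P) ∅ G.outer d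
    · exact ho.mono hAU
    -- Either `P i` is the upper path of the face of `d`, or a smaller path has `d` inside and the
    -- induction applies at once.
    by_cases hmin : ∀ r, d ∈ (P r).inside → ¬ (P r).gamma ⊂ (P i).gamma
    swap
    · push Not at hmin
      obtain ⟨r, hdr, hr⟩ := hmin
      exact ih _ hr r rfl d hdr
    set f : Set G.graph.Dart := {d' | G.Joined (unionEdges P) ∅ d d'} with hf
    have hside : ∀ x ∈ f, ∀ j, d ∈ (P j).inside ↔ x ∈ (P j).inside := fun x hx =>
      mem_inside_iff_of_joined ho hx
    have hup : IsUpperPath P i f := ⟨fun x hx => (hside x hx i).1 hd, fun r hr =>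
      hP.gamma_subset_of_minimal hd hmin (hr (PlaneGraph.Joined.refl d))⟩
    have hchild := fun e he => hP.exists_isChild_of_mem_lowerBoundary hd hmin ho (e := e) he
    have hne := lowerBoundary_nonempty i ho
    -- By minimality the face is outside the child `c` carrying `e`, so the far side of `e` is
    -- inside `c`, where the induction hypothesis holds.
    have cross : ∀ e ∈ lowerBoundary P i f, e ∉ A → G.Joined A ∅ G.outer d := by
      intro e he heA
      obtain ⟨c, hc, hec⟩ := hchild e he
      obtain ⟨⟨-, x, hx, rfl⟩, -⟩ := he
      have hxc : x.symm ∈ (P c).inside := (symm_mem_inside_iff_notMem hec).2 fun h =>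
        hmin c ((hside x hx c).2 h) hc.1
      exact (ih _ hc.1 c rfl _ hxc).trans ((PlaneGraph.Joined.cross heA).symm.trans (hx.mono hAU).symm)
    rcases hP.binary i with hno | ⟨c₁, c₂, hcc, hc, -⟩
    · obtain ⟨e, he⟩ := hne
      obtain ⟨c, hc, -⟩ := hchild e he
      exact absurd hc (hno c)
    · have hsub : lowerBoundary P i f ⊆ (P c₁).edges ∪ (P c₂).edges := by
        intro e he
        obtain ⟨c, hci, hec⟩ := hchild e he
        rcases (hc c).1 hci with rfl | rfl
        · exact Or.inl hec
        · exact Or.inr hec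
      obtain ⟨x, x', e, e', hxx, hx, hx'⟩ :=
        (hP.singleTouch c₁ c₂ hcc).exists_isExtremal hsub hne
      have hdisj := hL f ⟨d, rfl⟩ i hup x x' e e' hxx hx hx'
      -- The two extremal edges have no label in common, so at most one of them is in `A`; the other
      -- can be crossed.
      by_cases heA : e ∈ A
      · exact cross e' hx'.1 fun he' => Set.disjoint_left.1 hdisj (hA e heA) (hA e' he')
      · exact cross e hx.1 heA
  by_cases hd : d ∈ (P root).inside
  · exact key _ root rfl d hd
  · exact (hP.joined_outer_of_notMem_root hd).mono hAU

end PlanePaths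

theorem mainTheorem4 {V : Type*} [Finite V] (G : PlanePaths.PlaneGraph V) {ι : Type*}
    (P : ι → G.TerminalPath) (root : ι) (hP : PlanePaths.IsBinaryNCS P root)
    {k : ℕ} (L : ι → Fin k)
    (hL : ∀ f : Set G.graph.Dart, PlanePaths.IsFace P f → PlanePaths.IsSolved P L f) :
    PlanePaths.IsForestLabeling P L := by
  intro a
  refine PlanePaths.coe_isAcyclic_of_joined (hP.joined_outer hL a fun e he => ?_)
  simp only [SimpleGraph.Subgraph.edgeSet_iSup, Set.mem_iUnion] at he
  obtain ⟨i, hi, hei⟩ := he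
  exact ⟨i, (SimpleGraph.Walk.mem_edges_toSubgraph _).1 hei, hi⟩
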